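/- Theorem 4.1. Let $(\mathfrak H,(\cdot,\cdot))$ be a complex Hilbert space with a non-trivial fundamental symmetry $J$ (a bounded operator with $J=J^*$, $J^2=I$, $J\neq\pm I$), let $[x,y]=(Jx,y)$ and $\mathfrak H_\pm=\frac12(I\pm J)\mathfrak H$. Let $S$ be a closed, densely defined, symmetric operator in $\mathfrak H$ with $SJ=JS$ such that each of the restrictions $S_\pm=S\upharpoonright_{\mathfrak H_\pm}$, regarded as an operator in $\mathfrak H_\pm$, has deficiency indices $\langle 1,1\rangle$. Put $$\Sigma_J=\{A\supset S \mid A \text{ is self-adjoint with respect to } [\cdot,\cdot]\},$$ $$\mathfrak U=\{C \text{ a bounded operator on } \mathfrak H \mid C^2=I,\ JC>0,\ SC=CS\},$$ $$\Upsilon_J=\{A\in\Sigma_J\mid AJ=JA\},\qquad \Sigma_J^{st}=\{A\in\Sigma_J\mid \exists\, C\in\mathfrak U:\ AC=CA\},$$ $$\Upsilon_{\mathfrak U}=\{A\in\Sigma_J\mid AC=CA\ \ \forall\, C\in\mathfrak U\}.$$ If no operator in $\Sigma_J$ has empty resolvent set, then $$\Upsilon_{\mathfrak U}=\Upsilon_J=\Sigma_J^{st}.$$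 If, moreover, $S$ is simple (there is no nonzero closed subspace that reduces $S$ and in which the part of $S$ is self-adjoint), then $\mathfrak U=\{J\}$. -/

import Mathlib

namespace KreinExt

section General

variable {E : Type*} [NormedAddCommGroup E] [InnerProductSpace ℂ E]

/-- Densely defined operator. -/
def IsDenselyDefined (T : E →ₗ.[ℂ] E) : Prop :=
  Dense (T.domain : Set E)

/-- Symmetric operator: `(T x, y) = (x, T y)` for all `x, y ∈ D(T)`. -/
def IsSymmetricOp (T : E →ₗ.[ℂ] E) : Prop :=
  T.IsFormalAdjoint T

/-- The defect subspace `ker (T* - μ I)` of a densely defined operator `T`: all `y` such that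
`(T x, y) = (x, μ y)` for every `x ∈ D(T)`, that is, `y ∈ D(T*)` and `T* y = μ y`. -/
def defectSpace (T : E →ₗ.[ℂ] E) (μ : ℂ) : Submodule ℂ E where
  carrier := {y | ∀ x : T.domain, inner ℂ (T x) y = inner ℂ (x : E) (μ • y)}
  zero_mem' := by
    intro x
    simp
  add_mem' := by
    intro a b ha hb x
    rw [inner_add_right, ha x, hb x, smul_add, inner_add_right]
  smul_mem' := by
    intro c a ha x
    rw [inner_smul_right, ha x, smul_comm μ c a, inner_smul_right (x : E) (μ • a) c]

/-- The deficiency indices of `T` are `<m, n>`. -/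
def HasDeficiencyIndices (T : E →ₗ.[ℂ] E) (m n : ℕ) : Prop :=
  Module.rank ℂ (defectSpace T Complex.I) = m ∧ Module.rank ℂ (defectSpace T (-Complex.I)) = n

theorem mem_defectSpace_iff [CompleteSpace E] {T : E →ₗ.[ℂ] E} (hT : IsDenselyDefined T)
    (μ : ℂ) (y : E) : y ∈ defectSpace T μ ↔ (y, μ • y) ∈ T.adjoint.graph := by
  rw [LinearPMap.adjoint_graph_eq_graph_adjoint hT, Submodule.mem_adjoint_iff]
  constructor
  · intro h a b hab
    obtain ⟨x, rfl, rfl⟩ := (LinearPMap.mem_graph_iff T).1 hab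
    exact sub_eq_zero.2 (h x)
  · intro h x
    exact sub_eq_zero.1 (h x (T x) (T.mem_graph x))

/-- The operator `T` and the everywhere defined operator `C` commute, `T C = C T`, as an equality
of operators with domains `D(T C) = {x | C x ∈ D(T)}` and `D(C T) = D(T)`. -/
def CommutesWith (T : E →ₗ.[ℂ] E) (C : E →L[ℂ] E) : Prop :=
  (∀ x : E, C x ∈ T.domain ↔ x ∈ T.domain) ∧
    ∀ (x : E) (hx : x ∈ T.domain) (hCx : C x ∈ T.domain), T ⟨C x, hCx⟩ = C (T ⟨x, hx⟩)

/-- The resolvent set: all `μ` for which `T - μ I` is a bijection of `D(T)` onto the whole space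
with a bounded inverse. -/
def resolventSetOp (T : E →ₗ.[ℂ] E) : Set ℂ :=
  {μ | ∃ R : E →L[ℂ] E,
    (∀ x : T.domain, R (T x - μ • (x : E)) = x) ∧
    ∀ y : E, ∃ h : R y ∈ T.domain, T ⟨R y, h⟩ - μ • R y = y}

/-- The part of `T` in a subspace `L`, acting on all `x ∈ L ∩ D(T)` with `T x ∈ L`. When `L` is
invariant under `T`, it is the restriction of `T` to `L`, considered as an operator in `L`. -/
def part (T : E →ₗ.[ℂ] E) (L : Submodule ℂ E) : L →ₗ.[ℂ] L where
  domain :=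
    { carrier := {x | ∃ h : (x : E) ∈ T.domain, T ⟨x, h⟩ ∈ L}
      zero_mem' := ⟨T.domain.zero_mem, by
        have h : T ⟨((0 : L) : E), T.domain.zero_mem⟩ = 0 := T.map_zero
        rw [h]
        exact L.zero_mem⟩
      add_mem' := by
        rintro a b ⟨ha, ha'⟩ ⟨hb, hb'⟩
        refine ⟨T.domain.add_mem ha hb, ?_⟩
        have h : T ⟨((a + b : L) : E), T.domain.add_mem ha hb⟩ = T ⟨a, ha⟩ + T ⟨b, hb⟩ :=
          T.map_add ⟨a, ha⟩ ⟨b, hb⟩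
        rw [h]
        exact L.add_mem ha' hb'
      smul_mem' := by
        rintro c a ⟨ha, ha'⟩
        refine ⟨T.domain.smul_mem c ha, ?_⟩
        have h : T ⟨((c • a : L) : E), T.domain.smul_mem c ha⟩ = c • T ⟨a, ha⟩ :=
          T.map_smul c ⟨a, ha⟩
        rw [h]
        exact L.smul_mem c ha' }
  toFun :=
    { toFun := fun x => ⟨T ⟨x.1, x.2.1⟩, x.2.2⟩
      map_add' := by
        intro a b
        exact Subtype.ext (T.map_add ⟨a.1, a.2.1⟩ ⟨b.1, b.2.1⟩)
      map_smul' := by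
        intro c a
        exact Subtype.ext (T.map_smul c ⟨a.1, a.2.1⟩) }

/-- The closed subspace `L` reduces `T`: the orthogonal projection `P` onto `L` satisfies
`P T ⊆ T P`. -/
def Reduces (L : Submodule ℂ E) [L.HasOrthogonalProjection] (T : E →ₗ.[ℂ] E) : Prop :=
  ∀ x : T.domain, ∃ h : L.starProjection x ∈ T.domain,
    T ⟨L.starProjection x, h⟩ = L.starProjection (T x)

/-- A symmetric operator is simple if no nonzero closed subspace reduces it to a
self-adjoint operator. -/
def IsSimpleOp [CompleteSpace E] (T : E →ₗ.[ℂ] E) : Prop :=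
  ∀ (L : Submodule ℂ E) [CompleteSpace L], Reduces L T → IsSelfAdjoint (part T L) → L = ⊥

end General

section Krein

variable {H : Type*} [NormedAddCommGroup H] [InnerProductSpace ℂ H] [CompleteSpace H]

/-- A non-trivial fundamental symmetry: `J = J*`, `J² = I`, `J ≠ ± I`. -/
structure IsNontrivialFundamentalSymmetry (J : H →L[ℂ] H) : Prop where
  selfAdjoint : IsSelfAdjoint J
  sq : J * J = 1
  ne_one : J ≠ 1
  ne_neg_one : J ≠ -1

/-- `H₊ = ½ (I + J) H`. -/
noncomputable def plusSpace (J : H →L[ℂ] H) : Submodule ℂ H :=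
  LinearMap.range (((1 / 2 : ℂ) • (1 + J) : H →L[ℂ] H) : H →ₗ[ℂ] H)

/-- `H₋ = ½ (I - J) H`. -/
noncomputable def minusSpace (J : H →L[ℂ] H) : Submodule ℂ H :=
  LinearMap.range (((1 / 2 : ℂ) • (1 - J) : H →L[ℂ] H) : H →ₗ[ℂ] H)

/-- The indefinite inner product `[x, y] = (J x, y)`. -/
noncomputable def kreinForm (J : H →L[ℂ] H) (x y : H) : ℂ :=
  inner ℂ (J x) y

/-- `A` is `J`-self-adjoint: it is densely defined and equals its adjoint with respect to the
indefinite inner product, i.e. `y ∈ D(A)` and `A y = z` if and only if `[A x, y] = [x, z]` for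
all `x ∈ D(A)`. -/
def IsJSelfAdjoint (J : H →L[ℂ] H) (A : H →ₗ.[ℂ] H) : Prop :=
  IsDenselyDefined A ∧
    ∀ y z : H, (y, z) ∈ A.graph ↔
      ∀ x : A.domain, kreinForm J (A x) y = kreinForm J (x : H) z

/-- The bounded operator `B` satisfies `B > 0`. -/
def IsStrictlyPositiveOp (B : H →L[ℂ] H) : Prop :=
  B.IsPositive ∧ ∀ x : H, x ≠ 0 → 0 < (inner ℂ (B x) x).re

/-- `Σ_J`: all `J`-self-adjoint extensions of `S`. -/
def SigmaJ (J : H →L[ℂ] H) (S : H →ₗ.[ℂ] H) : Set (H →ₗ.[ℂ] H) :=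
  {A | S ≤ A ∧ IsJSelfAdjoint J A}

/-- `𝔘`: all bounded `C` with `C² = I`, `J C > 0` and `S C = C S`. -/
def USet (J : H →L[ℂ] H) (S : H →ₗ.[ℂ] H) : Set (H →L[ℂ] H) :=
  {C | C * C = 1 ∧ IsStrictlyPositiveOp (J * C) ∧ CommutesWith S C}

/-- `Υ_J`: all `A ∈ Σ_J` commuting with `J`. -/
def UpsilonJ (J : H →L[ℂ] H) (S : H →ₗ.[ℂ] H) : Set (H →ₗ.[ℂ] H) :=
  {A | A ∈ SigmaJ J S ∧ CommutesWith A J}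

/-- `Σ_J^{st}`: all `A ∈ Σ_J` commuting with some `C ∈ 𝔘`. -/
def SigmaJst (J : H →L[ℂ] H) (S : H →ₗ.[ℂ] H) : Set (H →ₗ.[ℂ] H) :=
  {A | A ∈ SigmaJ J S ∧ ∃ C ∈ USet J S, CommutesWith A C}

/-- `Υ_𝔘`: all `A ∈ Σ_J` commuting with every `C ∈ 𝔘`. -/
def UpsilonU (J : H →L[ℂ] H) (S : H →ₗ.[ℂ] H) : Set (H →ₗ.[ℂ] H) :=
  {A | A ∈ SigmaJ J S ∧ ∀ C ∈ USet J S, CommutesWith A C}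

end Krein

end KreinExt

/-!
For `C ∈ 𝔘` put `B = J C - C J`. It is self-adjoint, anticommutes with `J`, commutes with `S`, and
hence acts on each defect space `ker (S* - μ)`, which has dimension two. There `B² = c²` with a
constant `c ≥ 0` depending only on the half-plane containing `μ`.

If the two constants differ, then `ker (S* - μ)` and `ker (S* - ν)` are orthogonal for `μ` and `ν`
in opposite half-planes, since `B²` is self-adjoint. If they coincide and are nonzero, then the
`c`-eigenvectors of `B` are orthogonal to their images under `J`. Either way, extending `S` to
suitable `J`-neutral lines in `ker (S* - i)` and `ker (S* + i)` gives an `A ∈ Σ_J` having every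
nonreal number as an eigenvalue, so that the resolvent set of `A` is empty.

If `Σ_J` contains no such operator, then `B = 0` on `ker (S* ∓ i)`. There `J C` is a strictly
positive involution, that is, `C = J`. By von Neumann's decomposition of `S*`, the operator `C - J`
then commutes with every `A ∈ Σ_J`, and it vanishes if `S` is simple.
-/

namespace KreinExt

open LinearMap Submodule Topology
open scoped ComplexConjugate InnerProductSpace

section Defect

variable {E : Type*} [NormedAddCommGroup E] [InnerProductSpace ℂ E] {T : E →ₗ.[ℂ] E} {μ ν : ℂ}

theorem mem_graph_adjoint_iff {y z : E} :
    (y, z) ∈ T.graph.adjoint ↔ ∀ x : T.domain, ⟪T x, y⟫_ℂ = ⟪(x : E), z⟫_ℂ := by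
  rw [mem_adjoint_iff]
  refine ⟨fun h x ↦ sub_eq_zero.1 (h x (T x) (T.mem_graph x)), fun h a b hab ↦ ?_⟩
  obtain ⟨x, rfl, rfl⟩ := (LinearPMap.mem_graph_iff T).1 hab
  exact sub_eq_zero.2 (h x)

theorem mem_defectSpace_iff_mem_graph_adjoint {y : E} :
    y ∈ defectSpace T μ ↔ (y, μ • y) ∈ T.graph.adjoint :=
  mem_graph_adjoint_iff.symm

theorem inner_apply_of_mem_defectSpace {f : E} (hf : f ∈ defectSpace T μ) (x : T.domain) :
    ⟪T x, f⟫_ℂ = μ * ⟪(x : E), f⟫_ℂ :=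
  (hf x).trans (inner_smul_right _ _ _)

theorem IsDenselyDefined.eq_of_mem_graph_adjoint (hT : IsDenselyDefined T) {y z z' : E}
    (hz : (y, z) ∈ T.graph.adjoint) (hz' : (y, z') ∈ T.graph.adjoint) : z = z' :=
  hT.eq_of_inner_right ℂ fun v hv ↦
    (mem_graph_adjoint_iff.1 hz ⟨v, hv⟩).symm.trans (mem_graph_adjoint_iff.1 hz' ⟨v, hv⟩)

theorem IsSymmetricOp.graph_le_adjoint (hT : IsSymmetricOp T) : T.graph ≤ T.graph.adjoint := by
  rintro ⟨y, z⟩ hyz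
  obtain ⟨x, rfl, rfl⟩ := (LinearPMap.mem_graph_iff T).1 hyz
  exact mem_graph_adjoint_iff.2 fun v ↦ hT v x

/-- The operator `T - μ` as a linear map on the domain of `T`. -/
def shift (T : E →ₗ.[ℂ] E) (μ : ℂ) : T.domain →ₗ[ℂ] E :=
  T.toFun - μ • T.domain.subtype

@[simp]
theorem shift_apply (x : T.domain) : shift T μ x = T x - μ • (x : E) :=
  rfl

theorem orthogonal_range_shift (T : E →ₗ.[ℂ] E) (μ : ℂ) :
    (range (shift T μ))ᗮ = defectSpace T (conj μ) := by
  ext y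
  simp only [mem_orthogonal, LinearMap.mem_range, forall_exists_index, forall_apply_eq_imp_iff,
    shift_apply, inner_sub_left, inner_smul_left, sub_eq_zero,
    mem_defectSpace_iff_mem_graph_adjoint, mem_graph_adjoint_iff, inner_smul_right]

theorem IsSymmetricOp.inner_shift_conj_left (hT : IsSymmetricOp T) (μ : ℂ) (x y : T.domain) :
    ⟪shift T (conj μ) x, (y : E)⟫_ℂ = ⟪(x : E), shift T μ y⟫_ℂ := by
  rw [shift_apply, shift_apply, inner_sub_left, inner_sub_right, inner_smul_left,
    inner_smul_right, Complex.conj_conj, hT x y]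

theorem IsSymmetricOp.abs_im_mul_norm_le (hT : IsSymmetricOp T) (μ : ℂ) (x : T.domain) :
    |μ.im| * ‖(x : E)‖ ≤ ‖shift T μ x‖ := by
  have him : (⟪(x : E), shift T μ x⟫_ℂ).im = -(μ.im * ‖(x : E)‖ ^ 2) := by
    have hreal : (⟪(x : E), T x⟫_ℂ).im = 0 :=
      Complex.conj_eq_iff_im.1 ((inner_conj_symm _ _).trans (hT x x))
    rw [shift_apply, inner_sub_right, inner_smul_right, inner_self_eq_norm_sq_to_K, Complex.sub_im,
      hreal, ← RCLike.ofReal_pow, RCLike.ofReal_eq_complex_ofReal, Complex.im_mul_ofReal, zero_sub]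
  have hle : |μ.im| * ‖(x : E)‖ * ‖(x : E)‖ ≤ ‖shift T μ x‖ * ‖(x : E)‖ :=
    calc |μ.im| * ‖(x : E)‖ * ‖(x : E)‖ = |(⟪(x : E), shift T μ x⟫_ℂ).im| := by
          rw [him, abs_neg, abs_mul, abs_of_nonneg (sq_nonneg ‖(x : E)‖)]; ring
      _ ≤ ‖⟪(x : E), shift T μ x⟫_ℂ‖ := Complex.abs_im_le_norm _
      _ ≤ ‖(x : E)‖ * ‖shift T μ x‖ := norm_inner_le_norm _ _
      _ = ‖shift T μ x‖ * ‖(x : E)‖ := mul_comm _ _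
  rcases (norm_nonneg (x : E)).eq_or_lt with hx | hx
  · rw [← hx, mul_zero]
    exact norm_nonneg _
  · exact le_of_mul_le_mul_right hle hx

/-- The graph of the restriction of the scalar operator `μ` to a subspace `M`. -/
def scalarGraph (M : Submodule ℂ E) (μ : ℂ) : Submodule ℂ (E × E) :=
  M.map (LinearMap.id.prod (μ • LinearMap.id))

theorem mem_scalarGraph {M : Submodule ℂ E} {y : E} (hy : y ∈ M) : (y, μ • y) ∈ scalarGraph M μ :=
  ⟨y, hy, rfl⟩

theorem scalarGraph_defectSpace_le : scalarGraph (defectSpace T μ) μ ≤ T.graph.adjoint := by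
  rintro _ ⟨y, hy, rfl⟩
  exact mem_defectSpace_iff_mem_graph_adjoint.1 hy

variable [CompleteSpace E]

theorem IsSymmetricOp.isClosed_range_shift (hT : IsSymmetricOp T) (hTc : T.IsClosed)
    (hμ : μ.im ≠ 0) : IsClosed (range (shift T μ) : Set E) := by
  have : CompleteSpace T.graph := hTc.completeSpace_coe
  let φ : T.graph →L[ℂ] E :=
    (ContinuousLinearMap.snd ℂ E E - μ • ContinuousLinearMap.fst ℂ E E) ∘L T.graph.subtypeL
  have hanti : AntilipschitzWith (1 + (1 + ‖μ‖₊) / ‖μ.im‖₊) φ := by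
    refine φ.antilipschitz_of_bound fun p ↦ ?_
    obtain ⟨x, hx⟩ := (LinearPMap.mem_graph_iff' T).1 p.2
    have hφ : φ p = shift T μ x := by
      simp [φ, ← hx]
    have hfst : ‖(x : E)‖ ≤ ‖φ p‖ / |μ.im| :=
      (le_div_iff₀' (abs_pos.2 hμ)).2 (hφ ▸ hT.abs_im_mul_norm_le μ x)
    have hsnd : ‖T x‖ ≤ ‖φ p‖ + ‖μ‖ * ‖(x : E)‖ := by
      rw [hφ, ← norm_smul]
      exact norm_le_norm_sub_add _ _
    calc ‖p‖ = max ‖(x : E)‖ ‖T x‖ := by rw [coe_norm, ← hx, Prod.norm_mk]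
      _ ≤ ‖φ p‖ + (1 + ‖μ‖) * ‖(x : E)‖ :=
          max_le (by nlinarith [norm_nonneg μ, norm_nonneg (x : E), norm_nonneg (φ p)])
            (by linarith [norm_nonneg (x : E)])
      _ ≤ ‖φ p‖ + (1 + ‖μ‖) * (‖φ p‖ / |μ.im|) := by gcongr
      _ = ↑(1 + (1 + ‖μ‖₊) / ‖μ.im‖₊) * ‖φ p‖ := by
          simp only [NNReal.coe_add, NNReal.coe_one, NNReal.coe_div, coe_nnnorm, Real.norm_eq_abs]
          ring
  have hrange : (range (shift T μ) : Set E) = Set.range φ := by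
    ext w
    constructor
    · rintro ⟨x, rfl⟩
      exact ⟨⟨_, T.mem_graph x⟩, rfl⟩
    · rintro ⟨⟨_, hp⟩, rfl⟩
      obtain ⟨x, rfl⟩ := (LinearPMap.mem_graph_iff' T).1 hp
      exact ⟨x, rfl⟩
  exact hrange ▸ hanti.isClosed_range φ.uniformContinuous

theorem IsSymmetricOp.range_shift (hT : IsSymmetricOp T) (hTc : T.IsClosed) (hμ : μ.im ≠ 0) :
    range (shift T μ) = (defectSpace T (conj μ))ᗮ := by
  rw [← orthogonal_range_shift, orthogonal_orthogonal_eq_closure,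
    (hT.isClosed_range_shift hTc hμ).submodule_topologicalClosure_eq]

theorem IsSymmetricOp.exists_shift_add_eq (hT : IsSymmetricOp T) (hTc : T.IsClosed)
    (hμ : μ.im ≠ 0) (w : E) :
    ∃ x : T.domain, ∃ n ∈ defectSpace T (conj μ), shift T μ x + n = w := by
  have : (range (shift T μ)).HasOrthogonalProjection :=
    have := (hT.isClosed_range_shift hTc hμ).completeSpace_coe
    inferInstance
  obtain ⟨_, ⟨x, rfl⟩, n, hn, hw⟩ :=
    (range (shift T μ)).exists_add_mem_mem_orthogonal w
  exact ⟨x, n, orthogonal_range_shift T μ ▸ hn, hw.symm⟩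

theorem IsSymmetricOp.graph_adjoint_eq (hT : IsSymmetricOp T) (hTc : T.IsClosed) :
    T.graph.adjoint = T.graph ⊔
      (scalarGraph (defectSpace T Complex.I) Complex.I ⊔
        scalarGraph (defectSpace T (-Complex.I)) (-Complex.I)) := by
  refine le_antisymm ?_
    (sup_le hT.graph_le_adjoint
      (sup_le scalarGraph_defectSpace_le scalarGraph_defectSpace_le))
  rintro ⟨y, z⟩ hyz
  obtain ⟨x, n, hn, hxn⟩ :=
    hT.exists_shift_add_eq hTc (μ := -Complex.I) (by simp) (z + Complex.I • y)
  rw [map_neg, Complex.conj_I, neg_neg] at hn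
  -- `x` solves `(T + i) x = (z + i y) - n`, so `2 i a = n` leaves a vector of `ker (T* + i)`.
  set a : E := (2 * Complex.I)⁻¹ • n with ha
  have ha_mem : a ∈ defectSpace T Complex.I := smul_mem _ _ hn
  have hn_eq : n = (2 * Complex.I) • a := by
    rw [ha, smul_inv_smul₀ (mul_ne_zero two_ne_zero Complex.I_ne_zero)]
  have hz : z - T x - Complex.I • a = -Complex.I • (y - x - a) := by
    rw [shift_apply, hn_eq] at hxn
    rw [← sub_eq_iff_eq_add.2 hxn]
    module
  have hb : (y - x - a) ∈ defectSpace T (-Complex.I) := by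
    rw [mem_defectSpace_iff_mem_graph_adjoint, ← hz]
    exact sub_mem (sub_mem hyz (hT.graph_le_adjoint (T.mem_graph x)))
      (scalarGraph_defectSpace_le (mem_scalarGraph ha_mem))
  have hsum : (y, z) = ((x : E), T x) +
      ((a, Complex.I • a) + (y - x - a, -Complex.I • (y - x - a))) := by
    rw [← hz, Prod.mk_add_mk, Prod.mk_add_mk, add_sub_cancel, add_sub_cancel, add_sub_cancel,
      add_sub_cancel]
  rw [hsum]
  exact add_mem (mem_sup_left (T.mem_graph x)) (mem_sup_right
    (add_mem (mem_sup_left (mem_scalarGraph ha_mem)) (mem_sup_right (mem_scalarGraph hb))))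

theorem IsSymmetricOp.defectSpace_inf_orthogonal_eq_bot (hT : IsSymmetricOp T) (hTc : T.IsClosed)
    (hμν : ‖ν - μ‖ < |μ.im|) : defectSpace T ν ⊓ (defectSpace T μ)ᗮ = ⊥ := by
  rw [eq_bot_iff]
  rintro f ⟨hfν, hfμ⟩
  have hμ : (conj μ).im ≠ 0 := by
    rw [Complex.conj_im, neg_ne_zero, ← abs_pos]
    exact (norm_nonneg _).trans_lt hμν
  obtain ⟨x, rfl⟩ : f ∈ range (shift T (conj μ)) := by
    rwa [hT.range_shift hTc hμ, Complex.conj_conj]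
  set f := shift T (conj μ) x with hf
  have hinner : ⟪f, f⟫_ℂ = (ν - μ) * ⟪(x : E), f⟫_ℂ := by
    nth_rw 1 [hf]
    rw [shift_apply, inner_sub_left, inner_smul_left, Complex.conj_conj,
      inner_apply_of_mem_defectSpace hfν, sub_mul]
  have hle : |μ.im| * ‖(x : E)‖ ≤ ‖f‖ := by
    simpa only [Complex.conj_im, abs_neg] using hT.abs_im_mul_norm_le (conj μ) x
  have hsq : ‖f‖ ^ 2 ≤ ‖ν - μ‖ * ‖(x : E)‖ * ‖f‖ :=
    calc ‖f‖ ^ 2 = ‖(ν - μ) * ⟪(x : E), f⟫_ℂ‖ := by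
          rw [← hinner, inner_self_eq_norm_sq_to_K, norm_pow, RCLike.norm_ofReal, abs_norm]
      _ ≤ ‖ν - μ‖ * (‖(x : E)‖ * ‖f‖) := by
          rw [norm_mul]
          gcongr
          exact norm_inner_le_norm _ _
      _ = ‖ν - μ‖ * ‖(x : E)‖ * ‖f‖ := by ring
  rw [Submodule.mem_bot]
  by_contra hne
  have hfx : ‖f‖ ≤ ‖ν - μ‖ * ‖(x : E)‖ := by
    rw [sq] at hsq
    exact le_of_mul_le_mul_right hsq (norm_pos_iff.2 hne)
  have hx : 0 < ‖(x : E)‖ := norm_pos_iff.2 fun h ↦ hne <| by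
    rw [hf, (Subtype.ext h : x = 0), map_zero]
  exact (hle.trans hfx).not_gt (mul_lt_mul_of_pos_right hμν hx)

end Defect

theorem halfPlane_induction {r : ℂ → ℂ → Prop} (htrans : ∀ a b c, r a b → r b c → r a c)
    (hr : ∀ μ ν : ℂ, ‖ν - μ‖ < |μ.im| → r μ ν) {μ ν : ℂ} (hμν : 0 < μ.im * ν.im) : r μ ν := by
  have hconv : Convex ℝ {z : ℂ | 0 < μ.im * z.im} :=
    (convex_Ioi 0).linear_preimage (μ.im • Complex.imLm)
  refine hconv.isPreconnected.induction₂' r (fun a ha ↦ ?_) (fun a b c _ _ _ ↦ htrans a b c)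
    (mul_self_pos.2 (left_ne_zero_of_mul hμν.ne')) hμν
  have ha' : 0 < |a.im| := abs_pos.2 (right_ne_zero_of_mul (ne_of_gt ha))
  have hnhds : ∀ᶠ b in 𝓝 a, ‖b - a‖ < |a.im| ∧ ‖a - b‖ < |b.im| :=
    (ContinuousAt.eventually_lt (by fun_prop) (by fun_prop) (by simpa using ha')).and
      (ContinuousAt.eventually_lt (by fun_prop) (by fun_prop) (by simpa using ha'))
  exact (hnhds.filter_mono nhdsWithin_le_nhds).mono fun b hb ↦ ⟨hr a b hb.1, hr b a hb.2⟩

theorem rank_le_of_inf_orthogonal_eq_bot {𝕜 E : Type*} [RCLike 𝕜] [NormedAddCommGroup E]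
    [InnerProductSpace 𝕜 E] {U V : Submodule 𝕜 E} [V.HasOrthogonalProjection] (h : U ⊓ Vᗮ = ⊥) :
    Module.rank 𝕜 U ≤ Module.rank 𝕜 V := by
  refine LinearMap.rank_le_of_injective (V.orthogonalProjectionOnto.toLinearMap ∘ₗ U.subtype) ?_
  rw [← ker_eq_bot, eq_bot_iff]
  intro u hu
  have hu' : (u : E) ∈ U ⊓ Vᗮ := ⟨u.2, (orthogonalProjectionOnto_eq_zero_iff).1 hu⟩
  rwa [h, Submodule.mem_bot, ZeroMemClass.coe_eq_zero] at hu'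

section Commutant

variable {E : Type*} [NormedAddCommGroup E] [InnerProductSpace ℂ E]

/-- The algebra of bounded operators `K` commuting with a linear relation `g`, in the sense that
`(x, y) ∈ g` implies `(K x, K y) ∈ g`. For the graph of an operator `T` this is the inclusion
`K T ⊆ T K`, which, unlike `CommutesWith`, is stable under sums. -/
def commutant (g : Submodule ℂ (E × E)) : Subalgebra ℂ (E →L[ℂ] E) where
  carrier := {K | ∀ x y, (x, y) ∈ g → (K x, K y) ∈ g}
  mul_mem' hK hL x y h := hK _ _ (hL x y h)
  add_mem' hK hL x y h := g.add_mem (hK x y h) (hL x y h)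
  algebraMap_mem' c _ _ h := g.smul_mem c h

variable {T : E →ₗ.[ℂ] E} {K : E →L[ℂ] E}

theorem mem_commutant_graph_iff :
    K ∈ commutant T.graph ↔
      ∀ x : T.domain, ∃ h : K x ∈ T.domain, T ⟨K x, h⟩ = K (T x) := by
  refine ⟨fun hK x ↦ ?_, fun hK x y hxy ↦ ?_⟩
  · obtain ⟨⟨_, hdom⟩, rfl, hTK⟩ := (LinearPMap.mem_graph_iff _).1 (hK _ _ (T.mem_graph x))
    exact ⟨hdom, hTK⟩
  · obtain ⟨x, rfl, rfl⟩ := (LinearPMap.mem_graph_iff _).1 hxy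
    obtain ⟨hdom, hTK⟩ := hK x
    exact hTK ▸ T.mem_graph ⟨K x, hdom⟩

theorem CommutesWith.mem_commutant (h : CommutesWith T K) : K ∈ commutant T.graph :=
  mem_commutant_graph_iff.2 fun x ↦ ⟨(h.1 x).2 x.2, h.2 x x.2 _⟩

theorem reduces_iff_starProjection_mem_commutant {L : Submodule ℂ E} [L.HasOrthogonalProjection] :
    Reduces L T ↔ L.starProjection ∈ commutant T.graph :=
  mem_commutant_graph_iff.symm

variable [CompleteSpace E]

theorem mem_commutant_adjoint {g : Submodule ℂ (E × E)} (hK : star K ∈ commutant g) :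
    K ∈ commutant g.adjoint := by
  intro x y h
  rw [mem_adjoint_iff] at h ⊢
  intro a b hab
  simpa [ContinuousLinearMap.star_eq_adjoint, ContinuousLinearMap.adjoint_inner_left] using
    h _ _ (hK a b hab)

theorem apply_mem_defectSpace (hK : star K ∈ commutant T.graph) {μ : ℂ} {f : E}
    (hf : f ∈ defectSpace T μ) : K f ∈ defectSpace T μ := by
  rw [mem_defectSpace_iff_mem_graph_adjoint] at hf ⊢
  simpa only [map_smul] using mem_commutant_adjoint hK _ _ hf

end Commutant

section HalfPlane

variable {E : Type*} [NormedAddCommGroup E] [InnerProductSpace ℂ E] [CompleteSpace E]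
  {T : E →ₗ.[ℂ] E} {μ ν : ℂ}

theorem IsSymmetricOp.rank_defectSpace_eq (hT : IsSymmetricOp T) (hTc : T.IsClosed)
    (hμν : 0 < μ.im * ν.im) :
    Module.rank ℂ (defectSpace T μ) = Module.rank ℂ (defectSpace T ν) := by
  have hle {μ ν : ℂ} (hμν : 0 < μ.im * ν.im) :
      Module.rank ℂ (defectSpace T ν) ≤ Module.rank ℂ (defectSpace T μ) := by
    refine halfPlane_induction
      (r := fun μ ν ↦ Module.rank ℂ (defectSpace T ν) ≤ Module.rank ℂ (defectSpace T μ))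
      (fun _ _ _ h₁ h₂ ↦ h₂.trans h₁) (fun μ ν h ↦ ?_) hμν
    have : (defectSpace T μ).HasOrthogonalProjection := by
      rw [← Complex.conj_conj μ, ← orthogonal_range_shift]
      infer_instance
    exact rank_le_of_inf_orthogonal_eq_bot (hT.defectSpace_inf_orthogonal_eq_bot hTc h)
  exact le_antisymm (hle (mul_comm μ.im ν.im ▸ hμν)) (hle hμν)

theorem IsSymmetricOp.defectSpace_le_ker (hT : IsSymmetricOp T) (hTc : T.IsClosed)
    {K : E →L[ℂ] E} (hKsa : IsSelfAdjoint K) (hK : K ∈ commutant T.graph) (hμν : 0 < μ.im * ν.im)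
    (h : defectSpace T μ ≤ K.ker) : defectSpace T ν ≤ K.ker := by
  refine halfPlane_induction (r := fun μ ν ↦ defectSpace T μ ≤ K.ker → defectSpace T ν ≤ K.ker)
    (fun _ _ _ h₁ h₂ ↦ h₂ ∘ h₁) (fun μ ν hμν h f hf ↦ ?_) hμν h
  have horth : K f ∈ (defectSpace T μ)ᗮ := fun g hg ↦ by
    have hKg : K g = 0 := h hg
    rw [← hKsa.isSymmetric.apply_clm, hKg, inner_zero_left]
  have hmem : K f ∈ defectSpace T ν ⊓ (defectSpace T μ)ᗮ :=
    ⟨apply_mem_defectSpace (hKsa.star_eq.symm ▸ hK) hf, horth⟩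
  rwa [hT.defectSpace_inf_orthogonal_eq_bot hTc hμν, Submodule.mem_bot] at hmem

end HalfPlane

section SelfAdjoint

variable {E : Type*} [NormedAddCommGroup E] [InnerProductSpace ℂ E] [CompleteSpace E]
  {T : E →ₗ.[ℂ] E}

theorem isSelfAdjoint_iff_graph_adjoint_eq : IsSelfAdjoint T ↔ T.graph.adjoint = T.graph := by
  constructor
  · intro hT
    rw [← LinearPMap.adjoint_graph_eq_graph_adjoint hT.dense_domain,
      LinearPMap.isSelfAdjoint_def.1 hT]
  · intro hT
    have hdense : Dense (T.domain : Set E) := by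
      rw [dense_iff_topologicalClosure_eq_top, topologicalClosure_eq_top_iff, eq_bot_iff]
      intro y hy
      have hmem : ((0 : E), y) ∈ T.graph :=
        hT ▸ mem_graph_adjoint_iff.2 fun x ↦ by rw [inner_zero_right, hy x x.2]
      exact T.mem_graph_snd_inj hmem T.graph.zero_mem rfl
    exact LinearPMap.eq_of_eq_graph
      ((LinearPMap.adjoint_graph_eq_graph_adjoint hdense).trans hT)

theorem IsSymmetricOp.isSelfAdjoint_of_range_shift_eq_top (hT : IsSymmetricOp T)
    (hpos : range (shift T Complex.I) = ⊤) (hneg : range (shift T (-Complex.I)) = ⊤) :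
    IsSelfAdjoint T := by
  refine isSelfAdjoint_iff_graph_adjoint_eq.2 (le_antisymm ?_ hT.graph_le_adjoint)
  rintro ⟨y, z⟩ hyz
  obtain ⟨x, hx⟩ : z - Complex.I • y ∈ range (shift T Complex.I) := hpos ▸ mem_top
  rw [shift_apply] at hx
  have hdiff : y - x ∈ defectSpace T Complex.I := by
    have hz : z - T x = Complex.I • (y - x) := by
      rw [← sub_eq_zero] at hx ⊢
      rw [← neg_eq_zero, ← hx]
      module
    rw [mem_defectSpace_iff_mem_graph_adjoint, ← hz]
    exact sub_mem hyz (hT.graph_le_adjoint (T.mem_graph x))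
  have hbot : defectSpace T Complex.I = ⊥ := by
    rw [← neg_neg Complex.I, ← Complex.conj_I, ← map_neg, ← orthogonal_range_shift, hneg,
      top_orthogonal_eq_bot]
  rw [hbot, Submodule.mem_bot, sub_eq_zero] at hdiff
  subst hdiff
  rw [sub_left_inj] at hx
  exact hx ▸ T.mem_graph x

end SelfAdjoint

theorem IsSymmetricOp.reduces_of_isSelfAdjoint_part {E : Type*} [NormedAddCommGroup E]
    [InnerProductSpace ℂ E] {T : E →ₗ.[ℂ] E} (hT : IsSymmetricOp T) {L : Submodule ℂ E}
    [CompleteSpace L] (hL : IsSelfAdjoint (part T L)) : Reduces L T := by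
  intro x
  have hmem : (L.orthogonalProjectionOnto x, L.orthogonalProjectionOnto (T x)) ∈
      (part T L).graph := by
    rw [← isSelfAdjoint_iff_graph_adjoint_eq.1 hL, mem_graph_adjoint_iff]
    intro v
    rw [inner_orthogonalProjectionOnto_eq_of_mem_left,
      inner_orthogonalProjectionOnto_eq_of_mem_left]
    exact hT ⟨_, v.2.1⟩ x
  obtain ⟨⟨_, hdom, _⟩, rfl, hTv⟩ := (LinearPMap.mem_graph_iff _).1 hmem
  exact ⟨hdom, congrArg Subtype.val hTv⟩

section Simple

variable {E : Type*} [NormedAddCommGroup E] [InnerProductSpace ℂ E] [CompleteSpace E]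
  {T : E →ₗ.[ℂ] E}

theorem IsSymmetricOp.exists_shift_eq_of_mem_orthogonal_ker (hT : IsSymmetricOp T)
    (hTc : T.IsClosed) {K : E →L[ℂ] E} (hK : K ∈ commutant T.graph) {μ : ℂ} (hμ : μ.im ≠ 0)
    (hKμ : defectSpace T μ ≤ K.ker) (hKμ' : defectSpace T (conj μ) ≤ K.ker) {u : E}
    (hu : u ∈ K.kerᗮ) : ∃ x : T.domain, (x : E) ∈ K.kerᗮ ∧ shift T μ x = u := by
  obtain ⟨x, rfl⟩ : u ∈ range (shift T μ) :=
    hT.range_shift hTc hμ ▸ orthogonal_le hKμ' hu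
  refine ⟨x, fun w hw ↦ ?_, rfl⟩
  have hμ' : (conj μ).im ≠ 0 := by rwa [Complex.conj_im, neg_ne_zero]
  obtain ⟨w', n, hn, rfl⟩ := hT.exists_shift_add_eq hTc hμ' w
  rw [Complex.conj_conj] at hn
  have hKw' : K w' = 0 := by
    obtain ⟨hdom, hTK⟩ := mem_commutant_graph_iff.1 hK w'
    have hzero : shift T (conj μ) ⟨K w', hdom⟩ = 0 := by
      have hKn : K n = 0 := hKμ hn
      rw [shift_apply, hTK, ← map_smul, ← map_sub, ← shift_apply]
      simpa [hKn] using hw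
    have hle := hT.abs_im_mul_norm_le (conj μ) ⟨K w', hdom⟩
    rw [hzero, norm_zero] at hle
    exact norm_le_zero_iff.1 (nonpos_of_mul_nonpos_right hle (abs_pos.2 hμ'))
  have hnx : ⟪(x : E), n⟫_ℂ = 0 := by
    have horth : ⟪shift T μ x, n⟫_ℂ = 0 := (mem_orthogonal' _ _).1 hu n (hKμ hn)
    rw [shift_apply, inner_sub_left, inner_apply_of_mem_defectSpace hn, inner_smul_left,
      ← sub_mul, mul_eq_zero, sub_eq_zero] at horth
    exact horth.resolve_left fun h ↦ hμ (Complex.conj_eq_iff_im.1 h.symm)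
  rw [inner_add_left, hT.inner_shift_conj_left, (mem_orthogonal _ _).1 hu w' hKw', zero_add,
    ← inner_conj_symm, hnx, map_zero]

theorem IsSimpleOp.eq_zero_of_mem_commutant (hTs : IsSimpleOp T) (hT : IsSymmetricOp T)
    (hTc : T.IsClosed) {K : E →L[ℂ] E} (hK : K ∈ commutant T.graph)
    (hpos : defectSpace T Complex.I ≤ K.ker) (hneg : defectSpace T (-Complex.I) ≤ K.ker) :
    K = 0 := by
  set L : Submodule ℂ E := K.kerᗮ
  have hsymm : IsSymmetricOp (part T L) := fun x y ↦ hT ⟨x, x.2.1⟩ ⟨y, y.2.1⟩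
  have hrange {μ : ℂ} (hμ : μ.im ≠ 0) (hKμ : defectSpace T μ ≤ K.ker)
      (hKμ' : defectSpace T (conj μ) ≤ K.ker) : range (shift (part T L) μ) = ⊤ := by
    refine eq_top_iff.2 fun u _ ↦ ?_
    obtain ⟨x, hx, hxu⟩ := hT.exists_shift_eq_of_mem_orthogonal_ker hTc hK hμ hKμ hKμ' u.2
    have hTx : T x ∈ L := by
      rw [shift_apply, sub_eq_iff_eq_add] at hxu
      rw [hxu]
      exact add_mem u.2 (smul_mem _ _ hx)
    exact ⟨⟨⟨x, hx⟩, x.2, hTx⟩, Subtype.ext hxu⟩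
  have hsa : IsSelfAdjoint (part T L) :=
    hsymm.isSelfAdjoint_of_range_shift_eq_top
      (hrange (by simp) hpos (by rwa [Complex.conj_I]))
      (hrange (by simp) hneg (by rwa [map_neg, Complex.conj_I, neg_neg]))
  have hbot : K.kerᗮ = ⊥ := hTs L (hT.reduces_of_isSelfAdjoint_part hsa) hsa
  rw [orthogonal_eq_bot_iff] at hbot
  ext x
  exact (hbot ▸ mem_top : x ∈ K.ker)

end Simple

theorem orthogonalBilin_sup {R R₁ R₂ M M₁ M₂ : Type*} [CommSemiring R] [CommSemiring R₁]
    [CommSemiring R₂] [AddCommMonoid M] [Module R M] [AddCommMonoid M₁] [Module R₁ M₁]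
    [AddCommMonoid M₂] [Module R₂ M₂] {I₁ : R₁ →+* R} {I₂ : R₂ →+* R}
    {B : M₁ →ₛₗ[I₁] M₂ →ₛₗ[I₂] M} (U V : Submodule R₁ M₁) :
    (U ⊔ V).orthogonalBilin B = U.orthogonalBilin B ⊓ V.orthogonalBilin B := by
  refine le_antisymm (le_inf (orthogonalBilin_le le_sup_left) (orthogonalBilin_le le_sup_right)) ?_
  rintro q ⟨hqU, hqV⟩ p hp
  obtain ⟨u, hu, v, hv, rfl⟩ := mem_sup.1 hp
  rw [map_add, LinearMap.add_apply, hqU u hu, hqV v hv, add_zero]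

theorem dense_setOf_im_ne_zero : Dense {μ : ℂ | μ.im ≠ 0} :=
  (dense_compl_singleton (0 : ℝ)).preimage Complex.isOpenMap_im

theorem resolventSetOp_eq_empty_of_dense {E : Type*} [NormedAddCommGroup E]
    [InnerProductSpace ℂ E] {A : E →ₗ.[ℂ] E}
    (h : Dense {μ : ℂ | ∃ f : E, f ≠ 0 ∧ (f, μ • f) ∈ A.graph}) : resolventSetOp A = ∅ := by
  refine Set.eq_empty_of_forall_notMem fun μ ⟨R, hR, _⟩ ↦ ?_
  have hsmall : IsOpen {ν : ℂ | ‖R‖ * ‖ν - μ‖ < 1} := isOpen_lt (by fun_prop) (by fun_prop)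
  obtain ⟨ν, ⟨f, hf, hfA⟩, hν⟩ := h.exists_mem_open hsmall ⟨μ, by simp⟩
  obtain ⟨x, rfl, hx⟩ := (LinearPMap.mem_graph_iff A).1 hfA
  have hRx : R ((ν - μ) • (x : E)) = x := by
    have hAx : A x = ν • (x : E) := hx
    rw [sub_smul, ← hAx, hR]
  have hle : ‖(x : E)‖ ≤ ‖R‖ * ‖ν - μ‖ * ‖(x : E)‖ :=
    calc ‖(x : E)‖ = ‖R ((ν - μ) • (x : E))‖ := by rw [hRx]
      _ ≤ ‖R‖ * ‖(ν - μ) • (x : E)‖ := R.le_opNorm _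
      _ = ‖R‖ * ‖ν - μ‖ * ‖(x : E)‖ := by rw [norm_smul, mul_assoc]
  exact hle.not_gt (mul_lt_of_lt_one_left (norm_pos_iff.2 hf) hν)

section Lagrange

variable {H : Type*} [NormedAddCommGroup H] [InnerProductSpace ℂ H] {J : H →L[ℂ] H}
  {S A : H →ₗ.[ℂ] H}

/-- The Lagrange form `[z, f'] - [f, z']` of two pairs `(f, z)` and `(f', z')`. A densely defined
operator is `J`-self-adjoint if and only if its graph is its own orthogonal complement for it. -/
noncomputable def lagrangeForm (J : H →L[ℂ] H) : H × H →ₗ⋆[ℂ] H × H →ₗ[ℂ] ℂ :=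
  ((innerₛₗ ℂ).comp (J.toLinearMap ∘ₗ snd ℂ H H)).compl₂ (fst ℂ H H) -
    ((innerₛₗ ℂ).comp (J.toLinearMap ∘ₗ fst ℂ H H)).compl₂ (snd ℂ H H)

theorem lagrangeForm_apply (p q : H × H) :
    lagrangeForm J p q = ⟪J p.2, q.1⟫_ℂ - ⟪J p.1, q.2⟫_ℂ :=
  rfl

theorem lagrangeForm_smul_smul (f g : H) (μ ν : ℂ) :
    lagrangeForm J (f, μ • f) (g, ν • g) = (conj μ - ν) * ⟪J f, g⟫_ℂ := by
  rw [lagrangeForm_apply, map_smul, inner_smul_left, inner_smul_right, sub_mul]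

theorem mem_orthogonalBilin_scalarGraph_iff {M : Submodule ℂ H} {f : H} {μ ν : ℂ} :
    (f, ν • f) ∈ (scalarGraph M μ).orthogonalBilin (lagrangeForm J) ↔
      conj μ = ν ∨ f ∈ (M.map J.toLinearMap)ᗮ := by
  have hmem : (f, ν • f) ∈ (scalarGraph M μ).orthogonalBilin (lagrangeForm J) ↔
      ∀ m ∈ M, lagrangeForm J (m, μ • m) (f, ν • f) = 0 :=
    Set.forall_mem_image
  have hmap : f ∈ (M.map J.toLinearMap)ᗮ ↔ ∀ m ∈ M, ⟪J m, f⟫_ℂ = 0 :=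
    Set.forall_mem_image
  simp only [hmem, hmap, lagrangeForm_smul_smul, mul_eq_zero, sub_eq_zero, forall_or_left]

theorem scalarGraph_sup_inf_orthogonalBilin {N₁ N₂ M₁ M₂ : Submodule ℂ H}
    {μ : ℂ} (hμ : μ.im ≠ 0)
    (hM₁ : N₁ ⊓ (M₁.map J.toLinearMap)ᗮ = M₁) (hM₂ : N₂ ⊓ (M₂.map J.toLinearMap)ᗮ = M₂) :
    (scalarGraph N₁ μ ⊔ scalarGraph N₂ (conj μ)) ⊓
        (scalarGraph M₁ μ ⊔ scalarGraph M₂ (conj μ)).orthogonalBilin (lagrangeForm J) =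
      scalarGraph M₁ μ ⊔ scalarGraph M₂ (conj μ) := by
  have hμ' : conj μ ≠ μ := mt Complex.conj_eq_iff_im.1 hμ
  have hcross₁ (b : H) : (b, conj μ • b) ∈ (scalarGraph M₁ μ).orthogonalBilin (lagrangeForm J) :=
    mem_orthogonalBilin_scalarGraph_iff.2 (.inl rfl)
  have hcross₂ (a : H) :
      (a, μ • a) ∈ (scalarGraph M₂ (conj μ)).orthogonalBilin (lagrangeForm J) :=
    mem_orthogonalBilin_scalarGraph_iff.2 (.inl (Complex.conj_conj μ))
  have hdiag₁ {a : H} : (a, μ • a) ∈ (scalarGraph M₁ μ).orthogonalBilin (lagrangeForm J) ↔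
      a ∈ (M₁.map J.toLinearMap)ᗮ :=
    mem_orthogonalBilin_scalarGraph_iff.trans (or_iff_right hμ')
  have hdiag₂ {b : H} :
      (b, conj μ • b) ∈ (scalarGraph M₂ (conj μ)).orthogonalBilin (lagrangeForm J) ↔
        b ∈ (M₂.map J.toLinearMap)ᗮ :=
    mem_orthogonalBilin_scalarGraph_iff.trans
      (or_iff_right ((Complex.conj_conj μ).trans_ne hμ'.symm))
  rw [orthogonalBilin_sup]
  refine le_antisymm ?_ (sup_le ?_ ?_)
  · rintro _ ⟨hN, h₁, h₂⟩
    obtain ⟨_, ⟨a, ha, rfl⟩, _, ⟨b, hb, rfl⟩, rfl⟩ := mem_sup.1 hN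
    have ha' := hdiag₁.1 ((Submodule.add_mem_iff_left _ (hcross₁ b)).1 h₁)
    have hb' := hdiag₂.1 ((Submodule.add_mem_iff_right _ (hcross₂ a)).1 h₂)
    exact add_mem_sup (mem_scalarGraph (hM₁.le ⟨ha, ha'⟩)) (mem_scalarGraph (hM₂.le ⟨hb, hb'⟩))
  · rintro _ ⟨a, ha, rfl⟩
    obtain ⟨haN, ha'⟩ := hM₁.ge ha
    exact ⟨mem_sup_left (mem_scalarGraph haN), hdiag₁.2 ha', hcross₂ a⟩
  · rintro _ ⟨b, hb, rfl⟩
    obtain ⟨hbN, hb'⟩ := hM₂.ge hb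
    exact ⟨mem_sup_right (mem_scalarGraph hbN), hcross₁ b, hdiag₂.2 hb'⟩

theorem lagrangeForm_isRefl [CompleteSpace H] (hJ : IsSelfAdjoint J) :
    (lagrangeForm J).IsRefl := by
  have hskew (p q : H × H) : lagrangeForm J q p = -conj (lagrangeForm J p q) := by
    have hJsymm (x y : H) : ⟪J x, y⟫_ℂ = ⟪x, J y⟫_ℂ := hJ.isSymmetric x y
    rw [lagrangeForm_apply, lagrangeForm_apply, map_sub, inner_conj_symm, inner_conj_symm,
      hJsymm, hJsymm, neg_sub]
  intro p q hpq
  rw [hskew, hpq, map_zero, neg_zero]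

theorem isJSelfAdjoint_iff [CompleteSpace H] :
    IsJSelfAdjoint J A ↔
      IsDenselyDefined A ∧ A.graph.orthogonalBilin (lagrangeForm J) = A.graph := by
  refine and_congr_right fun _ ↦ ?_
  have hmem (y z : H) : (y, z) ∈ A.graph.orthogonalBilin (lagrangeForm J) ↔
      ∀ x : A.domain, kreinForm J (A x) y = kreinForm J (x : H) z := by
    rw [mem_orthogonalBilin_iff]
    refine ⟨fun h x ↦ sub_eq_zero.1 (h _ (A.mem_graph x)), fun h p hp ↦ ?_⟩
    obtain ⟨x, rfl⟩ := (LinearPMap.mem_graph_iff' A).1 hp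
    exact sub_eq_zero.2 (h x)
  rw [Submodule.ext_iff, Prod.forall]
  exact forall₂_congr fun y z ↦ by rw [hmem]; exact iff_comm

theorem orthogonalBilin_lagrangeForm_eq_adjoint {g : Submodule ℂ (H × H)} (hJJ : J * J = 1)
    (hJ : J ∈ commutant g) : g.orthogonalBilin (lagrangeForm J) = g.adjoint := by
  have hJJ' (x : H) : J (J x) = x := congr($hJJ x)
  ext ⟨y, z⟩
  rw [mem_orthogonalBilin_iff, mem_adjoint_iff]
  exact ⟨fun h a b hab ↦ by simpa only [lagrangeForm_apply, hJJ'] using h _ (hJ a b hab),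
    fun h p hp ↦ h _ _ (hJ p.1 p.2 hp)⟩

theorem graph_le_adjoint_of_mem_sigmaJ [CompleteSpace H] (hJJ : J * J = 1)
    (hJS : J ∈ commutant S.graph) (hA : A ∈ SigmaJ J S) : A.graph ≤ S.graph.adjoint := by
  rw [← (isJSelfAdjoint_iff.1 hA.2).2, ← orthogonalBilin_lagrangeForm_eq_adjoint hJJ hJS]
  exact orthogonalBilin_le (LinearPMap.le_graph_of_le hA.1)

variable [CompleteSpace H]

theorem exists_mem_sigmaJ_graph_eq (hSd : IsDenselyDefined S)
    {g : Submodule ℂ (H × H)} (hSg : S.graph ≤ g) (hgS : g ≤ S.graph.adjoint)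
    (hg : g.orthogonalBilin (lagrangeForm J) = g) : ∃ A ∈ SigmaJ J S, A.graph = g := by
  have hgraph : g.toLinearPMap.graph = g := toLinearPMap_graph_eq g fun ⟨x, y⟩ hxy hx ↦ by
    obtain rfl : x = 0 := hx
    exact hSd.eq_of_mem_graph_adjoint (hgS hxy) (zero_mem _)
  have hSA : S ≤ g.toLinearPMap := LinearPMap.le_of_le_graph (hSg.trans_eq hgraph.symm)
  refine ⟨_, ⟨hSA, isJSelfAdjoint_iff.2 ⟨hSd.mono hSA.1, ?_⟩⟩, hgraph⟩
  rw [hgraph, hg]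

theorem orthogonalBilin_graph_sup_eq (hJ : IsSelfAdjoint J) (hJJ : J * J = 1)
    (hJS : J ∈ commutant S.graph) {L N : Submodule ℂ (H × H)}
    (hN : S.graph.adjoint = S.graph ⊔ N) (hL : N ⊓ L.orthogonalBilin (lagrangeForm J) = L) :
    (S.graph ⊔ L).orthogonalBilin (lagrangeForm J) = S.graph ⊔ L := by
  have hSorth := orthogonalBilin_lagrangeForm_eq_adjoint hJJ hJS
  have hLadj : L ≤ S.graph.orthogonalBilin (lagrangeForm J) := by
    rw [hSorth, hN, ← hL]
    exact inf_le_left.trans le_sup_right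
  have hSL : S.graph ≤ L.orthogonalBilin (lagrangeForm J) :=
    (le_orthogonalBilin_orthogonalBilin (lagrangeForm_isRefl hJ)).trans (orthogonalBilin_le hLadj)
  rw [orthogonalBilin_sup, hSorth, hN, sup_inf_assoc_of_le _ hSL, hL]

theorem exists_mem_sigmaJ_resolventSetOp_eq_empty (hSd : IsDenselyDefined S)
    (hS : IsSymmetricOp S) (hSc : S.IsClosed) (hJ : IsSelfAdjoint J) (hJJ : J * J = 1)
    (hJS : J ∈ commutant S.graph) {M₁ M₂ : Submodule ℂ H}
    (hM₁ : defectSpace S Complex.I ⊓ (M₁.map J.toLinearMap)ᗮ = M₁)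
    (hM₂ : defectSpace S (-Complex.I) ⊓ (M₂.map J.toLinearMap)ᗮ = M₂)
    (hM : ∀ μ : ℂ, μ.im ≠ 0 → ∃ f ∈ defectSpace S μ, f ≠ 0 ∧
      f ∈ (M₁.map J.toLinearMap)ᗮ ∧ f ∈ (M₂.map J.toLinearMap)ᗮ) :
    ∃ A ∈ SigmaJ J S, resolventSetOp A = ∅ := by
  have hL := scalarGraph_sup_inf_orthogonalBilin (μ := Complex.I) (by simp) hM₁
    (by rwa [← Complex.conj_I] at hM₂)
  rw [Complex.conj_I] at hL
  have hadj := hS.graph_adjoint_eq hSc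
  have hself := orthogonalBilin_graph_sup_eq hJ hJJ hJS hadj hL
  obtain ⟨A, hA, hAgraph⟩ := exists_mem_sigmaJ_graph_eq hSd le_sup_left
    ((sup_le_sup_left (hL.ge.trans inf_le_left) _).trans_eq hadj.symm) hself
  refine ⟨A, hA, resolventSetOp_eq_empty_of_dense (dense_setOf_im_ne_zero.mono fun μ hμ ↦ ?_)⟩
  obtain ⟨f, hf, hf0, hf₁, hf₂⟩ := hM μ hμ
  refine ⟨f, hf0, ?_⟩
  rw [hAgraph, ← hself, orthogonalBilin_sup, orthogonalBilin_sup,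
    orthogonalBilin_lagrangeForm_eq_adjoint hJJ hJS]
  exact ⟨mem_defectSpace_iff_mem_graph_adjoint.1 hf,
    mem_orthogonalBilin_scalarGraph_iff.2 (.inr hf₁),
    mem_orthogonalBilin_scalarGraph_iff.2 (.inr hf₂)⟩

end Lagrange

section Splitting

variable {H : Type*} [NormedAddCommGroup H] [InnerProductSpace ℂ H] {J : H →L[ℂ] H}

theorem map_subtype_defectSpace_part {T : H →ₗ.[ℂ] H} {L : Submodule ℂ H}
    [L.HasOrthogonalProjection] (hLT : Reduces L T) (μ : ℂ) :
    (defectSpace (part T L) μ).map L.subtype = L ⊓ defectSpace T μ := by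
  have hproj (x : H) {y : H} (hy : y ∈ L) : ⟪L.starProjection x, y⟫_ℂ = ⟪x, y⟫_ℂ := by
    rw [inner_starProjection_left_eq_right, starProjection_eq_self_iff.2 hy]
  ext y
  constructor
  · rintro ⟨⟨y, hyL⟩, hy, rfl⟩
    refine ⟨hyL, fun x ↦ ?_⟩
    obtain ⟨hdom, hcomm⟩ := hLT x
    have hTL : T ⟨L.starProjection x, hdom⟩ ∈ L := hcomm ▸ starProjection_apply_mem L _
    have hinner := hy ⟨⟨_, starProjection_apply_mem L x⟩, hdom, hTL⟩
    calc ⟪T x, y⟫_ℂ = ⟪T ⟨L.starProjection x, hdom⟩, y⟫_ℂ := by rw [hcomm, hproj _ hyL]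
      _ = ⟪L.starProjection x, μ • y⟫_ℂ := hinner
      _ = ⟪(x : H), μ • y⟫_ℂ := hproj _ (L.smul_mem μ hyL)
  · rintro ⟨hyL, hy⟩
    exact ⟨⟨y, hyL⟩, fun x ↦ hy ⟨x, x.2.1⟩, rfl⟩

theorem rank_inf_defectSpace_eq {T : H →ₗ.[ℂ] H} {L : Submodule ℂ H}
    [L.HasOrthogonalProjection] (hLT : Reduces L T) (μ : ℂ) :
    Module.rank ℂ ↥(L ⊓ defectSpace T μ) = Module.rank ℂ (defectSpace (part T L) μ) := by
  rw [← map_subtype_defectSpace_part hLT]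
  exact (equivMapOfInjective _ L.injective_subtype _).rank_eq.symm

theorem minusSpace_eq_plusSpace_neg : minusSpace J = plusSpace (-J) := by
  rw [minusSpace, plusSpace, sub_eq_add_neg]

theorem mem_plusSpace_iff (hJJ : J * J = 1) {x : H} : x ∈ plusSpace J ↔ J x = x := by
  have hJJ' (x : H) : J (J x) = x := congr($hJJ x)
  constructor
  · rintro ⟨y, rfl⟩
    simp [hJJ', add_comm]
  · intro hx
    refine ⟨x, ?_⟩
    change (1 / 2 : ℂ) • (x + J x) = x
    rw [hx]
    module

theorem mem_minusSpace_iff (hJJ : J * J = 1) {x : H} : x ∈ minusSpace J ↔ J x = -x := by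
  rw [minusSpace_eq_plusSpace_neg, mem_plusSpace_iff ((neg_mul_neg J J).trans hJJ),
    _root_.neg_apply, neg_eq_iff_eq_neg]

theorem isStarProjection_half_one_add [CompleteSpace H] (hJ : IsSelfAdjoint J)
    (hJJ : J * J = 1) : IsStarProjection ((1 / 2 : ℂ) • (1 + J)) where
  isIdempotentElem := by
    rw [IsIdempotentElem, smul_mul_smul_comm, add_mul, mul_add, mul_add, hJJ, one_mul, one_mul,
      mul_one]
    module
  isSelfAdjoint := by
    have htwo : IsSelfAdjoint (1 / 2 : ℂ) := by simp [isSelfAdjoint_iff]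
    exact htwo.smul ((IsSelfAdjoint.one _).add hJ)

theorem rank_plusSpace_inf_defectSpace [CompleteSpace H] (hJ : IsSelfAdjoint J)
    (hJJ : J * J = 1) {S : H →ₗ.[ℂ] H} (hJS : J ∈ commutant S.graph) (μ : ℂ) :
    Module.rank ℂ ↥(plusSpace J ⊓ defectSpace S μ) =
      Module.rank ℂ (defectSpace (part S (plusSpace J)) μ) := by
  obtain ⟨_, hproj⟩ := isStarProjection_iff_eq_starProjection_range.1
    (isStarProjection_half_one_add hJ hJJ)
  have : (plusSpace J).HasOrthogonalProjection := ‹_›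
  have hmem : (1 / 2 : ℂ) • (1 + J) ∈ commutant S.graph :=
    Subalgebra.smul_mem _ (add_mem (one_mem _) hJS) _
  exact rank_inf_defectSpace_eq (reduces_iff_starProjection_mem_commutant.2 (hproj ▸ hmem)) μ

theorem rank_minusSpace_inf_defectSpace [CompleteSpace H] (hJ : IsSelfAdjoint J)
    (hJJ : J * J = 1) {S : H →ₗ.[ℂ] H} (hJS : J ∈ commutant S.graph) (μ : ℂ) :
    Module.rank ℂ ↥(minusSpace J ⊓ defectSpace S μ) =
      Module.rank ℂ (defectSpace (part S (minusSpace J)) μ) := by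
  rw [minusSpace_eq_plusSpace_neg]
  exact rank_plusSpace_inf_defectSpace hJ.neg ((neg_mul_neg J J).trans hJJ) (neg_mem hJS) μ

theorem plusSpace_inf_sup_minusSpace_inf (hJJ : J * J = 1) {N : Submodule ℂ H}
    (hJN : ∀ f ∈ N, J f ∈ N) : plusSpace J ⊓ N ⊔ minusSpace J ⊓ N = N := by
  have hJJ' (x : H) : J (J x) = x := congr($hJJ x)
  refine le_antisymm (sup_le inf_le_right inf_le_right) fun f hf ↦ mem_sup.2
    ⟨(1 / 2 : ℂ) • (f + J f), ⟨(mem_plusSpace_iff hJJ).2 ?_, ?_⟩,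
      (1 / 2 : ℂ) • (f - J f), ⟨(mem_minusSpace_iff hJJ).2 ?_, ?_⟩, by module⟩
  · rw [map_smul, map_add, hJJ', add_comm]
  · exact N.smul_mem _ (N.add_mem hf (hJN f hf))
  · rw [map_smul, map_sub, hJJ', ← smul_neg, neg_sub]
  · exact N.smul_mem _ (N.sub_mem hf (hJN f hf))

theorem disjoint_plusSpace_minusSpace (hJJ : J * J = 1) :
    Disjoint (plusSpace J) (minusSpace J) := by
  rw [Submodule.disjoint_def]
  intro x hp hm
  rw [mem_plusSpace_iff hJJ] at hp
  rw [mem_minusSpace_iff hJJ] at hm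
  have := IsAddTorsionFree.of_isTorsionFree ℂ H
  exact self_eq_neg.1 (hp.symm.trans hm)

theorem inner_eq_zero_of_mem_plusSpace_of_mem_minusSpace [CompleteSpace H] (hJ : IsSelfAdjoint J)
    (hJJ : J * J = 1) {u v : H} (hu : u ∈ plusSpace J) (hv : v ∈ minusSpace J) :
    ⟪u, v⟫_ℂ = 0 := by
  rw [mem_plusSpace_iff hJJ] at hu
  rw [mem_minusSpace_iff hJJ] at hv
  refine self_eq_neg.1 ?_
  calc ⟪u, v⟫_ℂ = ⟪J u, v⟫_ℂ := by rw [hu]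
    _ = -⟪u, v⟫_ℂ := by rw [hJ.isSymmetric.apply_clm, hv, inner_neg_right]

end Splitting

section Plane

variable {H : Type*} [NormedAddCommGroup H] [InnerProductSpace ℂ H] {J : H →L[ℂ] H}
  {N : Submodule ℂ H}

theorem rank_eq_two_of_rank_inf_eq_one (hJJ : J * J = 1) (hJN : ∀ f ∈ N, J f ∈ N)
    (hp : Module.rank ℂ ↥(plusSpace J ⊓ N) = 1) (hm : Module.rank ℂ ↥(minusSpace J ⊓ N) = 1) :
    Module.rank ℂ N = 2 := by
  have hsum := rank_sup_add_rank_inf_eq (plusSpace J ⊓ N) (minusSpace J ⊓ N)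
  have hdisj := (disjoint_plusSpace_minusSpace hJJ).mono (inf_le_left (b := N))
    (inf_le_left (b := N))
  rw [plusSpace_inf_sup_minusSpace_inf hJJ hJN, hdisj.eq_bot, hp, hm, rank_bot, add_zero] at hsum
  exact hsum.trans one_add_one_eq_two

theorem exists_norm_eq_one_of_rank_eq_one {M : Submodule ℂ H} (hM : Module.rank ℂ M = 1) :
    ∃ u ∈ M, ‖u‖ = 1 ∧ M ≤ ℂ ∙ u := by
  obtain ⟨u, hu, hu0, hMu⟩ := (rank_submodule_eq_one_iff M).1 hM
  have hnorm : ((‖u‖⁻¹ : ℝ) : ℂ) ≠ 0 := by simpa using hu0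
  refine ⟨((‖u‖⁻¹ : ℝ) : ℂ) • u, M.smul_mem _ hu, ?_, ?_⟩
  · rw [norm_smul, Complex.norm_real, norm_inv, norm_norm, inv_mul_cancel₀ (norm_ne_zero_iff.2 hu0)]
  · rwa [span_singleton_smul_eq hnorm.isUnit]

theorem inf_orthogonal_map_span_singleton_eq (hN : Module.rank ℂ N = 2)
    (hJN : ∀ f ∈ N, J f ∈ N) (hJJ : J * J = 1) {y : H} (hy : y ∈ N) (hy0 : y ≠ 0)
    (hneutral : ⟪J y, y⟫_ℂ = 0) : N ⊓ ((ℂ ∙ y).map J.toLinearMap)ᗮ = ℂ ∙ y := by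
  have hJy0 : J y ≠ 0 := fun h ↦ hy0 (by simpa [h] using congr($hJJ y).symm)
  have hfinrank : Module.finrank ℂ N = 2 := Module.finrank_eq_of_rank_eq hN
  have : FiniteDimensional ℂ N := Module.finite_of_finrank_eq_succ hfinrank
  have hspan : (ℂ ∙ J y) ≤ N := (span_singleton_le_iff_mem _ _).2 (hJN y hy)
  have hcompl : Module.finrank ℂ ↥(N ⊓ (ℂ ∙ J y)ᗮ) = 1 := by
    rw [inf_comm]
    exact finrank_add_inf_finrank_orthogonal' hspan (by rw [finrank_span_singleton hJy0, hfinrank])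
  rw [Submodule.map_span, Set.image_singleton]
  refine (eq_of_le_of_finrank_eq ?_ ((finrank_span_singleton hy0).trans hcompl.symm)).symm
  exact (span_singleton_le_iff_mem _ _).2 ⟨hy, mem_orthogonal_singleton_iff_inner_right.2 hneutral⟩

theorem exists_neutral [CompleteSpace H] (hJ : IsSelfAdjoint J) (hJJ : J * J = 1)
    (hp : Module.rank ℂ ↥(plusSpace J ⊓ N) = 1) (hm : Module.rank ℂ ↥(minusSpace J ⊓ N) = 1) :
    ∃ y ∈ N, y ≠ 0 ∧ ⟪J y, y⟫_ℂ = 0 := by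
  obtain ⟨u, ⟨hu, huN⟩, hu1, -⟩ := exists_norm_eq_one_of_rank_eq_one hp
  obtain ⟨v, ⟨hv, hvN⟩, hv1, -⟩ := exists_norm_eq_one_of_rank_eq_one hm
  have huv := inner_eq_zero_of_mem_plusSpace_of_mem_minusSpace hJ hJJ hu hv
  refine ⟨u + v, N.add_mem huN hvN, fun h ↦ ?_, ?_⟩
  · have huu : ⟪u, u + v⟫_ℂ = 1 := by
      rw [inner_add_right, huv, add_zero, inner_self_eq_norm_sq_to_K, hu1]
      norm_num
    simp [h] at huu
  · rw [map_add, (mem_plusSpace_iff hJJ).1 hu, (mem_minusSpace_iff hJJ).1 hv, inner_add_left,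
      inner_add_right, inner_add_right, inner_neg_left, inner_neg_left, huv,
      inner_eq_zero_symm.1 huv, inner_self_eq_norm_sq_to_K, inner_self_eq_norm_sq_to_K, hu1, hv1]
    ring

theorem exists_forall_mul_self_apply_eq_sq_smul [CompleteSpace H] (hJJ : J * J = 1)
    (hJN : ∀ f ∈ N, J f ∈ N) (hp : Module.rank ℂ ↥(plusSpace J ⊓ N) = 1)
    (hm : Module.rank ℂ ↥(minusSpace J ⊓ N) = 1) {B : H →L[ℂ] H} (hB : IsSelfAdjoint B)
    (hJB : J * B = -(B * J)) (hBN : ∀ f ∈ N, B f ∈ N) :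
    ∃ c : ℝ, 0 ≤ c ∧ ∀ f ∈ N, (B * B) f = ((c ^ 2 : ℝ) : ℂ) • f := by
  obtain ⟨u, ⟨hu, huN⟩, hu1, hspan_u⟩ := exists_norm_eq_one_of_rank_eq_one hp
  obtain ⟨v, ⟨hv, hvN⟩, hv1, hspan_v⟩ := exists_norm_eq_one_of_rank_eq_one hm
  have hJB' (x : H) : J (B x) = -B (J x) := congr($hJB x)
  have hBu : B u ∈ minusSpace J := (mem_minusSpace_iff hJJ).2 (by
    rw [hJB', (mem_plusSpace_iff hJJ).1 hu])
  have hBv : B v ∈ plusSpace J := (mem_plusSpace_iff hJJ).2 (by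
    rw [hJB', (mem_minusSpace_iff hJJ).1 hv, map_neg, neg_neg])
  obtain ⟨β, hβ⟩ := mem_span_singleton.1 (hspan_v ⟨hBu, hBN u huN⟩)
  obtain ⟨γ, hγ⟩ := mem_span_singleton.1 (hspan_u ⟨hBv, hBN v hvN⟩)
  have hβγ : conj β = γ := by
    have hsymm : ⟪B u, v⟫_ℂ = ⟪u, B v⟫_ℂ := hB.isSymmetric u v
    simpa [← hβ, ← hγ, inner_smul_left, inner_smul_right, inner_self_eq_norm_sq_to_K, hu1, hv1]
      using hsymm
  have hsq : β * γ = ((‖β‖ ^ 2 : ℝ) : ℂ) := by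
    rw [← hβγ, Complex.mul_conj', Complex.ofReal_pow]
  refine ⟨‖β‖, norm_nonneg β, fun f hf ↦ ?_⟩
  rw [← plusSpace_inf_sup_minusSpace_inf hJJ hJN] at hf
  obtain ⟨x, hx, y, hy, rfl⟩ := mem_sup.1 hf
  obtain ⟨a, rfl⟩ := mem_span_singleton.1 (hspan_u hx)
  obtain ⟨b, rfl⟩ := mem_span_singleton.1 (hspan_v hy)
  simp only [mul_apply_eq_comp, map_add, map_smul, ← hβ, ← hγ, ← hsq]
  module

end Plane

section Eigenvectors

variable {H : Type*} [NormedAddCommGroup H] [InnerProductSpace ℂ H]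

theorem exists_ne_zero_inner_eq_zero {N : Submodule ℂ H} (hN : 1 < Module.rank ℂ N) (z : H) :
    ∃ f ∈ N, f ≠ 0 ∧ ⟪z, f⟫_ℂ = 0 := by
  by_contra! h
  have hinj : Function.Injective (innerₛₗ ℂ z ∘ₗ N.subtype) := by
    refine ker_eq_bot.1 (ker_eq_bot'.2 fun f hf ↦ ?_)
    by_contra hf0
    exact h f f.2 (by simpa using hf0) hf
  have hle := lift_rank_le_of_injective _ hinj
  rw [Module.rank_self, Cardinal.lift_one, Cardinal.lift_le_one_iff] at hle
  exact hN.not_ge hle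

theorem exists_ne_zero_apply_eq_smul {J B : H →L[ℂ] H} (hJJ : J * J = 1) (hJB : J * B = -(B * J))
    {N : Submodule ℂ H} (hJN : ∀ f ∈ N, J f ∈ N) (hBN : ∀ f ∈ N, B f ∈ N) {c : ℂ}
    (hc : ∀ f ∈ N, (B * B) f = c ^ 2 • f) (hN : N ≠ ⊥) : ∃ f ∈ N, f ≠ 0 ∧ B f = c • f := by
  have hBJ (x : H) : B (J x) = -J (B x) := (neg_eq_iff_eq_neg.2 congr($hJB x)).symm
  obtain ⟨g, hg, hg0⟩ := N.ne_bot_iff.1 hN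
  by_cases h : B g + c • g = 0
  · have hJg0 : J g ≠ 0 := fun h ↦ hg0 (by simpa [h] using congr($hJJ g).symm)
    refine ⟨J g, hJN g hg, hJg0, ?_⟩
    rw [hBJ, eq_neg_of_add_eq_zero_left h, map_neg, map_smul, neg_neg]
  · refine ⟨B g + c • g, N.add_mem (hBN g hg) (N.smul_mem c hg), h, ?_⟩
    have hBB : B (B g) = c ^ 2 • g := hc g hg
    rw [map_add, map_smul, hBB]
    module

variable [CompleteSpace H]

theorem inner_eq_zero_of_apply_eq_smul {K : H →L[ℂ] H} (hK : IsSelfAdjoint K) {a b : ℝ}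
    (hab : a ≠ b) {f g : H} (hf : K f = (a : ℂ) • f) (hg : K g = (b : ℂ) • g) : ⟪f, g⟫_ℂ = 0 := by
  have hsymm : ⟪K f, g⟫_ℂ = ⟪f, K g⟫_ℂ := hK.isSymmetric f g
  rw [hf, hg, inner_smul_left, inner_smul_right, Complex.conj_ofReal] at hsymm
  exact (mul_eq_mul_right_iff.1 hsymm).resolve_left (by exact_mod_cast hab)

theorem IsSymmetricOp.forall_defectSpace_apply_eq_smul {T : H →ₗ.[ℂ] H} (hT : IsSymmetricOp T)
    (hTc : T.IsClosed) {K : H →L[ℂ] H} (hKsa : IsSelfAdjoint K) (hK : K ∈ commutant T.graph)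
    {a : ℝ} {μ ν : ℂ} (hμν : 0 < μ.im * ν.im) (h : ∀ f ∈ defectSpace T μ, K f = (a : ℂ) • f) :
    ∀ f ∈ defectSpace T ν, K f = (a : ℂ) • f := by
  have ha : IsSelfAdjoint (algebraMap ℂ (H →L[ℂ] H) a) := .algebraMap _ (Complex.conj_ofReal a)
  have hker := hT.defectSpace_le_ker hTc (hKsa.sub ha) (sub_mem hK (algebraMap_mem _ _)) hμν
    fun f hf ↦ sub_eq_zero.2 (h f hf)
  exact fun f hf ↦ sub_eq_zero.1 (hker hf)

end Eigenvectors

theorem im_mul_im_pos_or {μ : ℂ} (hμ : μ.im ≠ 0) :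
    0 < Complex.I.im * μ.im ∨ 0 < (-Complex.I).im * μ.im := by
  simpa using hμ.lt_or_gt.symm

section EmptyResolvent

variable {H : Type*} [NormedAddCommGroup H] [InnerProductSpace ℂ H] [CompleteSpace H]
  {J B : H →L[ℂ] H} {S : H →ₗ.[ℂ] H}

theorem exists_resolventSetOp_eq_empty_of_neutral (hSd : IsDenselyDefined S)
    (hS : IsSymmetricOp S) (hSc : S.IsClosed) (hJ : IsSelfAdjoint J) (hJJ : J * J = 1)
    (hJS : J ∈ commutant S.graph) (hrank : Module.rank ℂ (defectSpace S Complex.I) = 2)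
    (hrank' : Module.rank ℂ (defectSpace S (-Complex.I)) = 2) {y y' : H}
    (hy : y ∈ defectSpace S Complex.I) (hy0 : y ≠ 0) (hneutral : ⟪J y, y⟫_ℂ = 0)
    (hy' : y' ∈ defectSpace S (-Complex.I)) (hy0' : y' ≠ 0) (hneutral' : ⟪J y', y'⟫_ℂ = 0)
    (h : ∀ μ : ℂ, μ.im ≠ 0 → ∃ f ∈ defectSpace S μ, f ≠ 0 ∧ ⟪J y, f⟫_ℂ = 0 ∧ ⟪J y', f⟫_ℂ = 0) :
    ∃ A ∈ SigmaJ J S, resolventSetOp A = ∅ := by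
  have hJN (μ : ℂ) : ∀ f ∈ defectSpace S μ, J f ∈ defectSpace S μ := fun f hf ↦
    apply_mem_defectSpace (hJ.star_eq.symm ▸ hJS) hf
  have hmem {y f : H} (hf : ⟪J y, f⟫_ℂ = 0) : f ∈ ((ℂ ∙ y).map J.toLinearMap)ᗮ := by
    rw [Submodule.map_span, Set.image_singleton]
    exact mem_orthogonal_singleton_iff_inner_right.2 hf
  refine exists_mem_sigmaJ_resolventSetOp_eq_empty hSd hS hSc hJ hJJ hJS
    (inf_orthogonal_map_span_singleton_eq hrank (hJN _) hJJ hy hy0 hneutral)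
    (inf_orthogonal_map_span_singleton_eq hrank' (hJN _) hJJ hy' hy0' hneutral') fun μ hμ ↦ ?_
  obtain ⟨f, hf, hf0, hyf, hyf'⟩ := h μ hμ
  exact ⟨f, hf, hf0, hmem hyf, hmem hyf'⟩

theorem exists_resolventSetOp_eq_empty_of_eq (hSd : IsDenselyDefined S)
    (hS : IsSymmetricOp S) (hSc : S.IsClosed) (hJ : IsSelfAdjoint J) (hJJ : J * J = 1)
    (hJS : J ∈ commutant S.graph) (hrank : Module.rank ℂ (defectSpace S Complex.I) = 2)
    (hrank' : Module.rank ℂ (defectSpace S (-Complex.I)) = 2) (hB : IsSelfAdjoint B)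
    (hBS : B ∈ commutant S.graph) (hJB : J * B = -(B * J)) {c : ℝ} (hc0 : c ≠ 0)
    (hc : ∀ f ∈ defectSpace S Complex.I, (B * B) f = ((c ^ 2 : ℝ) : ℂ) • f)
    (hc' : ∀ f ∈ defectSpace S (-Complex.I), (B * B) f = ((c ^ 2 : ℝ) : ℂ) • f) :
    ∃ A ∈ SigmaJ J S, resolventSetOp A = ∅ := by
  have hBB : IsSelfAdjoint (B * B) := by simpa only [sq] using hB.pow 2
  have hrank_and_sq {μ : ℂ} (hμ : μ.im ≠ 0) : Module.rank ℂ (defectSpace S μ) = 2 ∧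
      ∀ f ∈ defectSpace S μ, (B * B) f = ((c ^ 2 : ℝ) : ℂ) • f := by
    obtain hμ | hμ := im_mul_im_pos_or hμ
    · exact ⟨(hS.rank_defectSpace_eq hSc hμ).symm.trans hrank,
        hS.forall_defectSpace_apply_eq_smul hSc hBB (mul_mem hBS hBS) hμ hc⟩
    · exact ⟨(hS.rank_defectSpace_eq hSc hμ).symm.trans hrank',
        hS.forall_defectSpace_apply_eq_smul hSc hBB (mul_mem hBS hBS) hμ hc'⟩
  have hexists {μ : ℂ} (hμ : μ.im ≠ 0) : ∃ f ∈ defectSpace S μ, f ≠ 0 ∧ B f = (c : ℂ) • f := by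
    obtain ⟨hrankμ, hsq⟩ := hrank_and_sq hμ
    refine exists_ne_zero_apply_eq_smul hJJ hJB
      (fun f ↦ apply_mem_defectSpace (hJ.star_eq.symm ▸ hJS))
      (fun f ↦ apply_mem_defectSpace (hB.star_eq.symm ▸ hBS)) (by simpa using hsq) ?_
    rw [ne_eq, ← Submodule.rank_eq_zero (R := ℂ), hrankμ]
    exact two_ne_zero
  have horth {f g : H} (hf : B f = (c : ℂ) • f) (hg : B g = (c : ℂ) • g) : ⟪J f, g⟫_ℂ = 0 := by
    have hBJ : B (J f) = -J (B f) := (neg_eq_iff_eq_neg.2 congr($hJB f)).symm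
    refine inner_eq_zero_of_apply_eq_smul hB (neg_ne_self.2 hc0) ?_ hg
    rw [hBJ, hf, map_smul, Complex.ofReal_neg, neg_smul]
  obtain ⟨y, hy, hy0, hBy⟩ := hexists (μ := Complex.I) (by simp)
  obtain ⟨y', hy', hy0', hBy'⟩ := hexists (μ := -Complex.I) (by simp)
  refine exists_resolventSetOp_eq_empty_of_neutral hSd hS hSc hJ hJJ hJS hrank hrank' hy hy0
    (horth hBy hBy) hy' hy0' (horth hBy' hBy') fun μ hμ ↦ ?_
  obtain ⟨f, hf, hf0, hBf⟩ := hexists hμ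
  exact ⟨f, hf, hf0, horth hBy hBf, horth hBy' hBf⟩

theorem exists_resolventSetOp_eq_empty_of_ne (hSd : IsDenselyDefined S)
    (hS : IsSymmetricOp S) (hSc : S.IsClosed) (hJ : IsSelfAdjoint J) (hJJ : J * J = 1)
    (hJS : J ∈ commutant S.graph) (hrank : Module.rank ℂ (defectSpace S Complex.I) = 2)
    (hrank' : Module.rank ℂ (defectSpace S (-Complex.I)) = 2) {y y' : H}
    (hy : y ∈ defectSpace S Complex.I) (hy0 : y ≠ 0) (hneutral : ⟪J y, y⟫_ℂ = 0)
    (hy' : y' ∈ defectSpace S (-Complex.I)) (hy0' : y' ≠ 0) (hneutral' : ⟪J y', y'⟫_ℂ = 0)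
    {K : H →L[ℂ] H} (hK : IsSelfAdjoint K) (hKS : K ∈ commutant S.graph) {a b : ℝ} (hab : a ≠ b)
    (ha : ∀ f ∈ defectSpace S Complex.I, K f = (a : ℂ) • f)
    (hb : ∀ f ∈ defectSpace S (-Complex.I), K f = (b : ℂ) • f) :
    ∃ A ∈ SigmaJ J S, resolventSetOp A = ∅ := by
  have hJy := apply_mem_defectSpace (hJ.star_eq.symm ▸ hJS) hy
  have hJy' := apply_mem_defectSpace (hJ.star_eq.symm ▸ hJS) hy'
  refine exists_resolventSetOp_eq_empty_of_neutral hSd hS hSc hJ hJJ hJS hrank hrank' hy hy0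
    hneutral hy' hy0' hneutral' fun μ hμ ↦ ?_
  obtain hμ | hμ := im_mul_im_pos_or hμ
  · have hrankμ := (hS.rank_defectSpace_eq hSc hμ).symm.trans hrank
    obtain ⟨f, hf, hf0, hyf⟩ := exists_ne_zero_inner_eq_zero
      (Cardinal.one_lt_two.trans_eq hrankμ.symm) (J y)
    exact ⟨f, hf, hf0, hyf, inner_eq_zero_of_apply_eq_smul hK hab.symm (hb _ hJy')
      (hS.forall_defectSpace_apply_eq_smul hSc hK hKS hμ ha f hf)⟩
  · have hrankμ := (hS.rank_defectSpace_eq hSc hμ).symm.trans hrank'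
    obtain ⟨f, hf, hf0, hyf'⟩ := exists_ne_zero_inner_eq_zero
      (Cardinal.one_lt_two.trans_eq hrankμ.symm) (J y')
    exact ⟨f, hf, hf0, inner_eq_zero_of_apply_eq_smul hK hab (ha _ hJy)
      (hS.forall_defectSpace_apply_eq_smul hSc hK hKS hμ hb f hf), hyf'⟩

theorem defectSpace_le_ker_of_anticommute (hSd : IsDenselyDefined S)
    (hS : IsSymmetricOp S) (hSc : S.IsClosed) (hJ : IsSelfAdjoint J) (hJJ : J * J = 1)
    (hJS : J ∈ commutant S.graph) (hplus : HasDeficiencyIndices (part S (plusSpace J)) 1 1)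
    (hminus : HasDeficiencyIndices (part S (minusSpace J)) 1 1)
    (hres : ∀ A ∈ SigmaJ J S, resolventSetOp A ≠ ∅) (hB : IsSelfAdjoint B)
    (hBS : B ∈ commutant S.graph) (hJB : J * B = -(B * J)) :
    defectSpace S Complex.I ≤ B.ker ∧ defectSpace S (-Complex.I) ≤ B.ker := by
  have hJN (μ : ℂ) : ∀ f ∈ defectSpace S μ, J f ∈ defectSpace S μ := fun f ↦
    apply_mem_defectSpace (hJ.star_eq.symm ▸ hJS)
  have hBN (μ : ℂ) : ∀ f ∈ defectSpace S μ, B f ∈ defectSpace S μ := fun f ↦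
    apply_mem_defectSpace (hB.star_eq.symm ▸ hBS)
  simp only [HasDeficiencyIndices, ← rank_plusSpace_inf_defectSpace hJ hJJ hJS,
    ← rank_minusSpace_inf_defectSpace hJ hJJ hJS, Nat.cast_one] at hplus hminus
  have hrank := rank_eq_two_of_rank_inf_eq_one hJJ (hJN _) hplus.1 hminus.1
  have hrank' := rank_eq_two_of_rank_inf_eq_one hJJ (hJN _) hplus.2 hminus.2
  obtain ⟨c, hc0, hc⟩ :=
    exists_forall_mul_self_apply_eq_sq_smul hJJ (hJN _) hplus.1 hminus.1 hB hJB (hBN _)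
  obtain ⟨c', hc0', hc'⟩ :=
    exists_forall_mul_self_apply_eq_sq_smul hJJ (hJN _) hplus.2 hminus.2 hB hJB (hBN _)
  have hcc' : c = c' := by
    by_contra hne
    obtain ⟨y, hy, hy0, hneutral⟩ := exists_neutral hJ hJJ hplus.1 hminus.1
    obtain ⟨y', hy', hy0', hneutral'⟩ := exists_neutral hJ hJJ hplus.2 hminus.2
    have hsq_ne : c ^ 2 ≠ c' ^ 2 := mt (pow_left_inj₀ hc0 hc0' two_ne_zero).1 hne
    obtain ⟨A, hA, hAres⟩ := exists_resolventSetOp_eq_empty_of_ne hSd hS hSc hJ hJJ hJS hrank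
      hrank' hy hy0 hneutral hy' hy0' hneutral' (sq B ▸ hB.pow 2) (mul_mem hBS hBS) hsq_ne hc hc'
    exact hres A hA hAres
  subst hcc'
  obtain rfl : c = 0 := by
    by_contra hne
    obtain ⟨A, hA, hAres⟩ := exists_resolventSetOp_eq_empty_of_eq hSd hS hSc hJ hJJ hJS hrank
      hrank' hB hBS hJB hne hc hc'
    exact hres A hA hAres
  have hker {f : H} (hf : (B * B) f = (((0 : ℝ) ^ 2 : ℝ) : ℂ) • f) : B f = 0 := by
    rw [← inner_self_eq_zero (𝕜 := ℂ), hB.isSymmetric.apply_clm, ← mul_apply_eq_comp, hf]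
    simp
  exact ⟨fun f hf ↦ hker (hc f hf), fun f hf ↦ hker (hc' f hf)⟩

end EmptyResolvent

section Stable

variable {H : Type*} [NormedAddCommGroup H] [InnerProductSpace ℂ H] {S T : H →ₗ.[ℂ] H}
  {J C D : H →L[ℂ] H}

theorem commutesWith_of_mem_commutant (hCC : C * C = 1) (hC : C ∈ commutant T.graph) :
    CommutesWith T C := by
  rw [mem_commutant_graph_iff] at hC
  refine ⟨fun x ↦ ⟨fun hx ↦ ?_, fun hx ↦ (hC ⟨x, hx⟩).1⟩, fun x hx _ ↦ (hC ⟨x, hx⟩).2⟩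
  have hCCx : C (C x) = x := congr($hCC x)
  exact hCCx ▸ (hC ⟨C x, hx⟩).1

theorem apply_eq_self_of_isStrictlyPositiveOp (hD : IsStrictlyPositiveOp D) {f : H}
    (hf : D (D f) = f) : D f = f := by
  by_contra hne
  have hneg : D (D f - f) = -(D f - f) := by rw [map_sub, hf, neg_sub]
  have hpos := hD.2 _ (sub_ne_zero.2 hne)
  rw [hneg, inner_neg_left, Complex.neg_re] at hpos
  exact (neg_nonpos.2 (inner_self_nonneg (𝕜 := ℂ))).not_gt hpos

theorem apply_eq_of_commute_apply (hJJ : J * J = 1) (hCC : C * C = 1)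
    (hJC : IsStrictlyPositiveOp (J * C)) {f : H} (hf : J (C f) = C (J f)) : C f = J f := by
  have hJJ' (x : H) : J (J x) = x := congr($hJJ x)
  have hCC' (x : H) : C (C x) = x := congr($hCC x)
  have hinvol : (J * C) ((J * C) f) = f := by
    simp only [mul_apply_eq_comp, hf, hCC', hJJ']
  have hfix : J (C f) = f := apply_eq_self_of_isStrictlyPositiveOp hJC hinvol
  rw [← hJJ' (C f), hfix]

theorem mem_USet_self (hJJ : J * J = 1) (hSJ : CommutesWith S J) : J ∈ USet J S := by
  refine ⟨hJJ, ⟨hJJ ▸ ContinuousLinearMap.isPositive_one, fun x hx ↦ ?_⟩, hSJ⟩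
  rw [hJJ]
  exact (re_inner_self_pos (𝕜 := ℂ)).2 hx

variable [CompleteSpace H]

theorem IsSymmetricOp.mem_commutant_of_defectSpace_le_ker (hT : IsSymmetricOp T)
    (hTc : T.IsClosed) (hD : D ∈ commutant T.graph) (hpos : defectSpace T Complex.I ≤ D.ker)
    (hneg : defectSpace T (-Complex.I) ≤ D.ker) {g : Submodule ℂ (H × H)} (hTg : T.graph ≤ g)
    (hg : g ≤ T.graph.adjoint) : D ∈ commutant g := by
  intro x y hxy
  have hxy' := hg hxy
  rw [hT.graph_adjoint_eq hTc] at hxy'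
  obtain ⟨⟨s, t⟩, hst, _, hab, hsum⟩ := mem_sup.1 hxy'
  obtain ⟨_, ⟨a, ha, rfl⟩, _, ⟨b, hb, rfl⟩, rfl⟩ := mem_sup.1 hab
  obtain ⟨rfl, rfl⟩ := Prod.mk.inj hsum
  have hDa : D a = 0 := hpos ha
  have hDb : D b = 0 := hneg hb
  simpa [hDa, hDb] using hTg (hD s t hst)

theorem defectSpace_le_ker_sub_of_mem_USet (hSd : IsDenselyDefined S)
    (hS : IsSymmetricOp S) (hSc : S.IsClosed) (hJ : IsSelfAdjoint J) (hJJ : J * J = 1)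
    (hJS : J ∈ commutant S.graph) (hplus : HasDeficiencyIndices (part S (plusSpace J)) 1 1)
    (hminus : HasDeficiencyIndices (part S (minusSpace J)) 1 1)
    (hres : ∀ A ∈ SigmaJ J S, resolventSetOp A ≠ ∅) (hC : C ∈ USet J S) :
    defectSpace S Complex.I ≤ (C - J).ker ∧ defectSpace S (-Complex.I) ≤ (C - J).ker := by
  obtain ⟨hCC, hJCpos, hSC⟩ := hC
  have hJC : IsSelfAdjoint (J * C) := hJCpos.1.isSelfAdjoint
  have hCJ : IsSelfAdjoint (C * J) := by
    have hconj : J * (J * C) * J = C * J := by rw [← mul_assoc, hJJ, one_mul]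
    exact hconj ▸ hJC.conjugate_self hJ
  have hmem : J * C - C * J ∈ commutant S.graph :=
    sub_mem (mul_mem hJS hSC.mem_commutant) (mul_mem hSC.mem_commutant hJS)
  have hanti : J * (J * C - C * J) = -((J * C - C * J) * J) := by
    rw [mul_sub, sub_mul, ← mul_assoc, hJJ, one_mul, mul_assoc C, hJJ, mul_one, neg_sub,
      mul_assoc]
  have hker {f : H} (hf : f ∈ (J * C - C * J).ker) : f ∈ (C - J).ker :=
    sub_eq_zero.2 (apply_eq_of_commute_apply hJJ hCC hJCpos (sub_eq_zero.1 hf))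
  obtain ⟨hpos, hneg⟩ := defectSpace_le_ker_of_anticommute hSd hS hSc hJ hJJ hJS hplus hminus hres
    (hJC.sub hCJ) hmem hanti
  exact ⟨fun f hf ↦ hker (hpos hf), fun f hf ↦ hker (hneg hf)⟩

theorem commutesWith_iff_of_mem_USet (hSd : IsDenselyDefined S)
    (hS : IsSymmetricOp S) (hSc : S.IsClosed) (hJ : IsSelfAdjoint J) (hJJ : J * J = 1)
    (hJS : J ∈ commutant S.graph) (hplus : HasDeficiencyIndices (part S (plusSpace J)) 1 1)
    (hminus : HasDeficiencyIndices (part S (minusSpace J)) 1 1)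
    (hres : ∀ A ∈ SigmaJ J S, resolventSetOp A ≠ ∅) (hC : C ∈ USet J S) {A : H →ₗ.[ℂ] H}
    (hA : A ∈ SigmaJ J S) : CommutesWith A C ↔ CommutesWith A J := by
  obtain ⟨hpos, hneg⟩ :=
    defectSpace_le_ker_sub_of_mem_USet hSd hS hSc hJ hJJ hJS hplus hminus hres hC
  have hdiff : C - J ∈ commutant A.graph :=
    hS.mem_commutant_of_defectSpace_le_ker hSc (sub_mem hC.2.2.mem_commutant hJS) hpos hneg
      (LinearPMap.le_graph_of_le hA.1) (graph_le_adjoint_of_mem_sigmaJ hJJ hJS hA)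
  refine ⟨fun h ↦ commutesWith_of_mem_commutant hJJ ?_,
    fun h ↦ commutesWith_of_mem_commutant hC.1 ?_⟩
  · exact sub_sub_cancel C J ▸ sub_mem h.mem_commutant hdiff
  · exact sub_add_cancel C J ▸ add_mem hdiff h.mem_commutant

end Stable

end KreinExt

theorem theorem4p1 {H : Type*} [NormedAddCommGroup H] [InnerProductSpace ℂ H] [CompleteSpace H]
    (J : H →L[ℂ] H) (hJ : KreinExt.IsNontrivialFundamentalSymmetry J)
    (S : H →ₗ.[ℂ] H) (hSdense : KreinExt.IsDenselyDefined S) (hSclosed : S.IsClosed)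
    (hSsymm : KreinExt.IsSymmetricOp S) (hSJ : KreinExt.CommutesWith S J)
    (hdef_plus :
      KreinExt.HasDeficiencyIndices (KreinExt.part S (KreinExt.plusSpace J)) 1 1)
    (hdef_minus :
      KreinExt.HasDeficiencyIndices (KreinExt.part S (KreinExt.minusSpace J)) 1 1)
    (hres : ∀ A ∈ KreinExt.SigmaJ J S, KreinExt.resolventSetOp A ≠ ∅) :
    (KreinExt.UpsilonU J S = KreinExt.UpsilonJ J S ∧
      KreinExt.UpsilonJ J S = KreinExt.SigmaJst J S) ∧
    (KreinExt.IsSimpleOp S → KreinExt.USet J S = {J}) := by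
  have hJS := hSJ.mem_commutant
  have hJU := KreinExt.mem_USet_self hJ.sq hSJ
  have hcomm {C : H →L[ℂ] H} (hC : C ∈ KreinExt.USet J S) {A : H →ₗ.[ℂ] H}
      (hA : A ∈ KreinExt.SigmaJ J S) : KreinExt.CommutesWith A C ↔ KreinExt.CommutesWith A J :=
    KreinExt.commutesWith_iff_of_mem_USet hSdense hSsymm hSclosed hJ.selfAdjoint hJ.sq hJS
      hdef_plus hdef_minus hres hC hA
  refine ⟨⟨?_, ?_⟩, fun hSsimple ↦ Set.eq_singleton_iff_unique_mem.2 ⟨hJU, fun C hC ↦ ?_⟩⟩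
  · ext A
    exact and_congr_right fun hA ↦ ⟨fun h ↦ h J hJU, fun h C hC ↦ (hcomm hC hA).2 h⟩
  · ext A
    exact and_congr_right fun hA ↦ ⟨fun h ↦ ⟨J, hJU, h⟩, fun ⟨C, hC, h⟩ ↦ (hcomm hC hA).1 h⟩
  · obtain ⟨hpos, hneg⟩ := KreinExt.defectSpace_le_ker_sub_of_mem_USet hSdense hSsymm hSclosed
      hJ.selfAdjoint hJ.sq hJS hdef_plus hdef_minus hres hC
    exact sub_eq_zero.1 (hSsimple.eq_zero_of_mem_commutant hSsymm hSclosed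
      (sub_mem hC.2.2.mem_commutant hJS) hpos hneg)
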